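/- Let $X=(X_t)_{t\ge 0}$ be a right-continuous, time-homogeneous continuous-time Markov chain on a finite state space $E$ with laws $(\mathbb P_x)_{x\in E}$, $\mathbb P_x(X_0=x)=1$, and Markov generator $\mathcal Q=(Q(x,y))_{x,y\in E}$ (so $\sum_y Q(x,y)=0$, and $Q(x,y)\ge 0$ for $x\ne y$). Let $\beta>0$ and $\psi,\phi\in\mathbb R^E$ with $0\le\psi\le\phi$. Write $\mathcal Q[f](x)=\sum_y Q(x,y)f(y)$, $h(A)=\inf\{t\ge 0: X_t\in A\}$ for $A\subset E$, and, for $[0,\infty]$-valued stopping times $\tau,\gamma$ of the natural filtration of $X$, $$R_x(\tau,\gamma)=\mathbb E_x\big[e^{-\beta\tau}\psi(X_\tau)\mathbf 1_{\{\tau\le\gamma\}}+e^{-\beta\gamma}\phi(X_\gamma)\mathbf 1_{\{\tau>\gamma\}}\big],$$ with the convention $e^{-\beta\eta}f(X_\eta)=0$ on $\{\eta=+\infty\}$. Let $V_0(x)=\sup_\tau\mathbb E_x[e^{-\beta\tau}\psi(X_\tau)]$, the supremum being over all such stopping times. For a set $S_1\subset E$, the run started from $S_1$ is the sequence $(S_k,V_k,D_k)_{k\ge1}$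 defined as follows. For $k\ge 1$, $$V_k(x)=\sup_\tau R_x(\tau,h(S_k)),\qquad S_{k+1}=\big(S_k\cap\{\mathcal Q[V_k]-\beta V_k\ge 0\}\big)\cup\{\phi=\psi\},\qquad D_k=\bigcap_{n\ge 1}D_k^{(n)},$$ where $D_k^{(1)}=\{\mathcal Q[\psi]-\beta\psi\le 0\}\setminus S_k$ and, for $n\ge1$, $V_k^{(n)}(x)=R_x(h(D_k^{(n)}),h(S_k))$ and $D_k^{(n+1)}=\{\mathcal Q[V_k^{(n)}]-\beta V_k^{(n)}\le 0\}\cap D_k^{(n)}$. Let $(S_k,V_k,D_k)_{k\ge1}$ be the run started from $S_1=\{V_0>\phi\}\cup\{\phi=\psi\}$, and let $(\widetilde S_k,\widetilde V_k,\widetilde D_k)_{k\ge1}$ be the run started from $\widetilde S_1=\{V_0\ge\phi\}$. Then, for all $k\ge 1$, $$S_k\subset\widetilde S_k,\qquad \widetilde D_k\subset D_k,\qquad \widetilde V_k\ge V_k \text{ on } E.$$ -/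

import Mathlib

open MeasureTheory
open scoped NNReal Matrix

noncomputable section

namespace StoppingGame

/-- Markov generators on a finite set: zero row sums, nonnegative off-diagonal entries. -/
structure IsMarkovGenerator {E : Type*} [Fintype E] (Q : Matrix E E ℝ) : Prop where
  row_sum : ∀ x, ∑ y, Q x y = 0
  off_diag : ∀ x y, x ≠ y → 0 ≤ Q x y

/-- A time-homogeneous, right-continuous continuous-time Markov chain `(X, (ℙ_x))` on the finite
set `E` (with its discrete topology and σ-algebra), with generator `Q`, on the measurable
space `Ω`. The transition matrices are `P_t(x, y) = ℙ_x(X_t = y)`. -/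
structure MarkovChain {E : Type*} [Fintype E] [TopologicalSpace E] [DiscreteTopology E]
    [MeasurableSpace E] [BorelSpace E] (Q : Matrix E E ℝ) (Ω : Type*) [MeasurableSpace Ω] where
  /-- The process. -/
  X : ℝ≥0 → Ω → E
  /-- The law of the chain started at a given state. -/
  P : E → Measure Ω
  prob : ∀ x, IsProbabilityMeasure (P x)
  meas : ∀ t, StronglyMeasurable (X t)
  right_cont : ∀ ω t, ContinuousWithinAt (fun s => X s ω) (Set.Ici t) t
  start : ∀ x, ∀ᵐ ω ∂(P x), X 0 ω = x
  /-- The (homogeneous) Markov property with respect to the natural filtration: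
  `ℙ_x(A ∩ {X_{s+t} = y}) = ∑ z, ℙ_x(A ∩ {X_s = z}) P_t(z, y)` for every `A ∈ F_s`. -/
  markov : ∀ (x : E) (s t : ℝ≥0) (y : E) (A : Set Ω),
    MeasurableSet[Filtration.natural X meas s] A →
      (P x).real (A ∩ X (s + t) ⁻¹' {y}) =
        ∑ z, (P x).real (A ∩ X s ⁻¹' {z}) * (P z).real (X t ⁻¹' {y})
  /-- `Q` is the derivative at time `0` of the transition matrices. -/
  generator : ∀ x y, HasDerivWithinAt (fun t : ℝ => (P x).real (X t.toNNReal ⁻¹' {y}))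
    (Q x y) (Set.Ici 0) 0

variable {E : Type*} [Fintype E] [TopologicalSpace E] [DiscreteTopology E]
  [MeasurableSpace E] [BorelSpace E] {Q : Matrix E E ℝ} {Ω : Type*} [MeasurableSpace Ω]

/-- The set `𝓜` of stopping times of the natural filtration of `X`, with values in `[0, ∞]`. -/
def StoppingTime (M : MarkovChain Q Ω) : Type _ :=
  {τ : Ω → WithTop ℝ≥0 // IsStoppingTime (Filtration.natural M.X M.meas) τ}

/-- The first hitting time `h(A) = inf {t ≥ 0 : X_t ∈ A}`, equal to `∞` if `A` is never hit. -/
def hit (M : MarkovChain Q Ω) (A : Set E) : Ω → WithTop ℝ≥0 :=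
  hittingAfter M.X A 0

/-- The discounted value `e^{-β τ} f(X_τ)`, equal to `0` where `τ = ∞`. -/
def discounted (M : MarkovChain Q Ω) (β : ℝ) (f : E → ℝ) (τ : Ω → WithTop ℝ≥0) (ω : Ω) : ℝ :=
  match τ ω with
  | ⊤ => 0
  | (t : ℝ≥0) => Real.exp (-β * t) * f (M.X t ω)

/-- The expected payoff
`R_x(τ, γ) = 𝔼_x[e^{-β τ} ψ(X_τ) 1_{τ ≤ γ} + e^{-β γ} φ(X_γ) 1_{τ > γ}]`. -/
def payoff (M : MarkovChain Q Ω) (β : ℝ) (ψ φ : E → ℝ) (τ γ : Ω → WithTop ℝ≥0) (x : E) : ℝ :=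
  ∫ ω, (if τ ω ≤ γ ω then discounted M β ψ τ ω else discounted M β φ γ ω) ∂(M.P x)

/-- The value `V_0(x) = sup_τ 𝔼_x[e^{-β τ} ψ(X_τ)]` of the one-player problem. -/
def V₀ (M : MarkovChain Q Ω) (β : ℝ) (ψ : E → ℝ) (x : E) : ℝ :=
  ⨆ τ : StoppingTime M, ∫ ω, discounted M β ψ τ.1 ω ∂(M.P x)

/-- The function `𝒬[f] - β f`. -/
def gen (Q : Matrix E E ℝ) (β : ℝ) (f : E → ℝ) (x : E) : ℝ :=
  (Q *ᵥ f) x - β * f x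

/-- The function `x ↦ sup_τ R_x(τ, h(S))`. -/
def bestReply (M : MarkovChain Q Ω) (β : ℝ) (ψ φ : E → ℝ) (S : Set E) (x : E) : ℝ :=
  ⨆ τ : StoppingTime M, payoff M β ψ φ τ.1 (hit M S) x

/-- The inner recursion of the algorithm for a given set `S`: index `n` here is the set
`D^{(n+1)}`, where `D^{(1)} = {𝒬[ψ] - β ψ ≤ 0} ∩ Sᶜ` and
`D^{(n+1)} = {𝒬[V^{(n)}] - β V^{(n)} ≤ 0} ∩ D^{(n)}` with `V^{(n)}(x) = R_x(h(D^{(n)}), h(S))`. -/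
def innerD (M : MarkovChain Q Ω) (β : ℝ) (ψ φ : E → ℝ) (S : Set E) : ℕ → Set E
  | 0 => {x | gen Q β ψ x ≤ 0} ∩ Sᶜ
  | n + 1 => {x | gen Q β (payoff M β ψ φ (hit M (innerD M β ψ φ S n)) (hit M S)) x ≤ 0} ∩
      innerD M β ψ φ S n

/-- The sets `S_1, S_2, …` of the run started from `S₁`; index `k` here is the set `S_{k+1}`:
`S_{k+1} = (S_k ∩ {𝒬[V_k] - β V_k ≥ 0}) ∪ {φ = ψ}` with `V_k(x) = sup_τ R_x(τ, h(S_k))`. -/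
def runS (M : MarkovChain Q Ω) (β : ℝ) (ψ φ : E → ℝ) (S₁ : Set E) : ℕ → Set E
  | 0 => S₁
  | k + 1 => (runS M β ψ φ S₁ k ∩
      {x | 0 ≤ gen Q β (bestReply M β ψ φ (runS M β ψ φ S₁ k)) x}) ∪ {x | φ x = ψ x}

/-- The functions `V_1, V_2, …` of the run started from `S₁`; index `k` here is `V_{k+1}`. -/
def runV (M : MarkovChain Q Ω) (β : ℝ) (ψ φ : E → ℝ) (S₁ : Set E) (k : ℕ) : E → ℝ :=
  bestReply M β ψ φ (runS M β ψ φ S₁ k)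

/-- The sets `D_1, D_2, …` of the run started from `S₁`; index `k` here is the set
`D_{k+1} = ⋂ n, D_{k+1}^{(n)}`. -/
def runD (M : MarkovChain Q Ω) (β : ℝ) (ψ φ : E → ℝ) (S₁ : Set E) (k : ℕ) : Set E :=
  ⋂ n, innerD M β ψ φ (runS M β ψ φ S₁ k) n

/-- The initial set `S_1 = {V_0 > φ} ∪ {φ = ψ}`. -/
def initS (M : MarkovChain Q Ω) (β : ℝ) (ψ φ : E → ℝ) : Set E :=
  {x | φ x < V₀ M β ψ x} ∪ {x | φ x = ψ x}

/-- The larger initial set `{V_0 ≥ φ}`. -/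
def initS' (M : MarkovChain Q Ω) (β : ℝ) (ψ φ : E → ℝ) : Set E :=
  {x | φ x ≤ V₀ M β ψ x}

end StoppingGame

end

open MeasureTheory Filter Topology
open scoped NNReal Matrix

noncomputable section

namespace StoppingGame

/-! ### The transition semigroup and its resolvent. -/

section Semigroup

variable {E : Type*} [Fintype E] [TopologicalSpace E] [DiscreteTopology E]
  [MeasurableSpace E] [BorelSpace E] {Q : Matrix E E ℝ} {Ω : Type*} [MeasurableSpace Ω]

/-! Everything reduces to a deterministic obstacle problem for `𝒬 - β` on a finite set. For any `S`,
the best reply `V` to `h(S)` satisfies `V = φ` on `S`, `V ≥ ψ` everywhere, `𝒬[V] - βV ≤ 0` off `S`,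
with equality off `S ∪ {V = ψ}` (all drawn from `exists_innerD_stable`). The limit of the inner
recursion is the contact set `{V = ψ} \ S` (`iInter_innerD_eq`).

The theorem then follows from two forms of the maximum principle: the comparison `le_of_gen_le_gen`,
and the touching principle `gen_le_gen_of_eq` (if `f ≤ g` with equality at `x`, then `𝒬[f] - βf ≤
𝒬[g] - βg` at `x`). Along the run from the smaller set, `V_k ≤ φ` (`runV_initS_le`). If `S_k ⊆
S̃_k`, then `V_k ≤ φ = Ṽ_k` on `S̃_k`, and off `S̃_k` the function `Ṽ_k` is a supersolution above
`ψ`, so `V_k ≤ Ṽ_k`. Both functions equal `φ` on `S_k`, so touching passes the condition `𝒬[V_k] -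
βV_k ≥ 0` on to `Ṽ_k`, which gives `S_{k+1} ⊆ S̃_{k+1}`. Off `S̃_k`, `ψ ≤ V_k ≤ Ṽ_k` turns contact
of `Ṽ_k` with `ψ` into contact of `V_k`.

The link to the chain is Dynkin's formula at an arbitrary stopping time (`integral_discounted_eq`),
derived from the Markov property at fixed times. It gives the verification results
`payoff_le_of_supersolution` and `payoff_hit_eq_of_dirichlet`. -/

instance (M : MarkovChain Q Ω) (x : E) : IsProbabilityMeasure (M.P x) := M.prob x

/-- The transition semigroup of the chain, acting on functions. -/
def semigroup (M : MarkovChain Q Ω) (t : ℝ≥0) (f : E → ℝ) (x : E) : ℝ :=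
  ∑ y, (M.P x).real (M.X t ⁻¹' {y}) * f y

lemma MarkovChain.measurable_X (M : MarkovChain Q Ω) (t : ℝ≥0) : Measurable (M.X t) :=
  (M.meas t).measurable

lemma MarkovChain.measurableSet_X_eq (M : MarkovChain Q Ω) (t : ℝ≥0) (y : E) :
    MeasurableSet (M.X t ⁻¹' {y}) :=
  M.measurable_X t (measurableSet_singleton y)

lemma norm_apply_le_sum {ι : Type*} [Fintype ι] (f : ι → ℝ) (x : ι) : ‖f x‖ ≤ ∑ y, |f y| :=
  Finset.single_le_sum (f := fun y => |f y|) (fun _ _ => abs_nonneg _) (Finset.mem_univ x)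

lemma integrable_comp_X (M : MarkovChain Q Ω) (f : E → ℝ) (t : ℝ≥0) (x : E) :
    Integrable (fun ω => f (M.X t ω)) (M.P x) :=
  Integrable.of_bound ((measurable_of_finite f).comp (M.measurable_X t)).aestronglyMeasurable
    (∑ y, |f y|) (ae_of_all _ fun _ => norm_apply_le_sum f _)

lemma setIntegral_comp_X (M : MarkovChain Q Ω) (f : E → ℝ) (t : ℝ≥0) (x : E) (A : Set Ω) :
    ∫ ω in A, f (M.X t ω) ∂(M.P x) = ∑ y, (M.P x).real (A ∩ M.X t ⁻¹' {y}) * f y := by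
  classical
  have h1 : ∀ ω, f (M.X t ω) = ∑ y, (M.X t ⁻¹' {y}).indicator (fun _ => f y) ω := by
    intro ω
    rw [Finset.sum_eq_single (M.X t ω)]
    · simp
    · intro b _ hb
      simp [Set.indicator, Ne.symm hb]
    · simp
  simp_rw [h1]
  rw [integral_finsetSum]
  · refine Finset.sum_congr rfl fun y _ => ?_
    rw [setIntegral_indicator (M.measurableSet_X_eq t y), setIntegral_const, smul_eq_mul]
  · intro y _
    exact (integrable_const _).indicator (M.measurableSet_X_eq t y)

lemma setIntegral_comp_X_add (M : MarkovChain Q Ω) (f : E → ℝ) (s t : ℝ≥0) (x : E) {A : Set Ω}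
    (hA : MeasurableSet[Filtration.natural M.X M.meas s] A) :
    ∫ ω in A, f (M.X (s + t) ω) ∂(M.P x) =
      ∑ z, (M.P x).real (A ∩ M.X s ⁻¹' {z}) * semigroup M t f z := by
  rw [setIntegral_comp_X M f (s + t) x A]
  simp_rw [M.markov x s t _ A hA, semigroup, Finset.sum_mul, Finset.mul_sum]
  rw [Finset.sum_comm]
  simp_rw [mul_assoc]

lemma semigroup_eq_integral (M : MarkovChain Q Ω) (f : E → ℝ) (t : ℝ≥0) (x : E) :
    semigroup M t f x = ∫ ω, f (M.X t ω) ∂(M.P x) := by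
  have := setIntegral_comp_X M f t x Set.univ
  simp only [Measure.restrict_univ, Set.univ_inter] at this
  rw [this, semigroup]

lemma semigroup_add (M : MarkovChain Q Ω) (f : E → ℝ) (s t : ℝ≥0) (x : E) :
    semigroup M (s + t) f x = semigroup M s (semigroup M t f) x := by
  have := setIntegral_comp_X_add M f s t x
    (A := Set.univ) (@MeasurableSet.univ _ (Filtration.natural M.X M.meas s))
  simp only [Measure.restrict_univ, Set.univ_inter] at this
  rw [semigroup_eq_integral, this]
  rfl

lemma semigroup_zero (M : MarkovChain Q Ω) (f : E → ℝ) (x : E) : semigroup M 0 f x = f x := by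
  rw [semigroup_eq_integral, integral_congr_ae (g := fun _ => f x)]
  · simp
  · filter_upwards [M.start x] with ω hω
    rw [hω]

lemma abs_semigroup_le (M : MarkovChain Q Ω) (f : E → ℝ) (t : ℝ≥0) (x : E) :
    |semigroup M t f x| ≤ ∑ y, |f y| := by
  refine (Finset.abs_sum_le_sum_abs _ _).trans (Finset.sum_le_sum fun y _ => ?_)
  rw [abs_mul, abs_of_nonneg measureReal_nonneg]
  exact mul_le_of_le_one_left (abs_nonneg _) measureReal_le_one

lemma semigroup_sub (M : MarkovChain Q Ω) (f g : E → ℝ) (t : ℝ≥0) (x : E) :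
    semigroup M t (fun y => f y - g y) x = semigroup M t f x - semigroup M t g x := by
  simp [semigroup, mul_sub, Finset.sum_sub_distrib]

lemma semigroup_gen (M : MarkovChain Q Ω) (β : ℝ) (f : E → ℝ) (t : ℝ≥0) (x : E) :
    semigroup M t (gen Q β f) x = semigroup M t (Q *ᵥ f) x - β * semigroup M t f x := by
  simp only [semigroup, gen, mul_sub, Finset.sum_sub_distrib, Finset.mul_sum]
  congr 1
  exact Finset.sum_congr rfl fun y _ => by ring

lemma hasDerivWithinAt_semigroup_zero (M : MarkovChain Q Ω) (f : E → ℝ) (x : E) :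
    HasDerivWithinAt (fun t : ℝ => semigroup M t.toNNReal f x) ((Q *ᵥ f) x) (Set.Ici 0) 0 := by
  have := HasDerivWithinAt.fun_sum (u := Finset.univ)
    fun (y : E) _ => (M.generator x y).mul_const (f y)
  exact this

/-- Writing `P_t f = P_s (P_{t-s} f)` reduces the claim to the right derivative at `0`, taken inside
a finite sum. -/
lemma hasDerivWithinAt_semigroup (M : MarkovChain Q Ω) (f : E → ℝ) (x : E) {s : ℝ} (hs : 0 ≤ s) :
    HasDerivWithinAt (fun t : ℝ => semigroup M t.toNNReal f x)
      (semigroup M s.toNNReal (Q *ᵥ f) x) (Set.Ici s) s := by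
  have h1 : HasDerivWithinAt (fun t : ℝ => t - s) 1 (Set.Ici s) s :=
    (hasDerivWithinAt_id s _).sub_const s
  have h2 : HasDerivWithinAt (fun t : ℝ => semigroup M s.toNNReal
      (fun z => semigroup M (t - s).toNNReal f z) x)
      (semigroup M s.toNNReal (Q *ᵥ f) x) (Set.Ici s) s := by
    refine HasDerivWithinAt.fun_sum (u := Finset.univ) fun (y : E) _ => ?_
    refine HasDerivWithinAt.const_mul _ ?_
    have h3 := hasDerivWithinAt_semigroup_zero M f y
    have h4 := HasDerivWithinAt.scomp (h := fun t : ℝ => t - s) s (by simpa using h3) h1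
      (fun t ht => by simpa using ht)
    simpa [Function.comp_def] using h4
  refine h2.congr_of_mem (fun t ht => ?_) Set.self_mem_Ici
  have : t.toNNReal = s.toNNReal + (t - s).toNNReal := by
    rw [← Real.toNNReal_add hs (sub_nonneg.2 ht), add_sub_cancel]
  rw [this, semigroup_add]

lemma abs_semigroup_sub_le (M : MarkovChain Q Ω) (f : E → ℝ) (x : E) (s t : ℝ≥0) :
    |semigroup M (s + t) f x - semigroup M s f x| ≤ ∑ y, |semigroup M t f y - f y| := by
  rw [semigroup_add, ← semigroup_sub]
  exact abs_semigroup_le _ _ _ _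

/-- Since `P_s` does not amplify, increments of length `t` are controlled uniformly in `s` by the
increment at `0`. This gives continuity from both sides, which right derivatives alone would not. -/
lemma continuous_semigroup (M : MarkovChain Q Ω) (f : E → ℝ) (x : E) :
    Continuous (fun t : ℝ≥0 => semigroup M t f x) := by
  have h0 : ∀ y, Tendsto (fun t : ℝ≥0 => semigroup M t f y - f y) (𝓝 0) (𝓝 0) := by
    intro y
    have h1 := (hasDerivWithinAt_semigroup_zero M f y).continuousWithinAt.tendsto
    have h2 : Tendsto (fun t : ℝ≥0 => (t : ℝ)) (𝓝 0) (𝓝[Set.Ici 0] 0) :=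
      tendsto_nhdsWithin_iff.2 ⟨by simpa using (NNReal.continuous_coe.tendsto 0),
        Eventually.of_forall fun t => t.2⟩
    have h3 := (h1.comp h2).sub_const (f y)
    simpa [Function.comp_def, semigroup_zero] using h3
  have hm : Tendsto (fun t : ℝ≥0 => ∑ y, |semigroup M t f y - f y|) (𝓝 0) (𝓝 0) := by
    simpa using tendsto_finsetSum Finset.univ fun y _ => (h0 y).abs
  rw [continuous_iff_continuousAt]
  intro s
  -- Subtraction in `ℝ≥0` is truncated, so this sum is `|t - s|`.
  have hd : Tendsto (fun t : ℝ≥0 => (t - s) + (s - t)) (𝓝 s) (𝓝 0) := by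
    have : Continuous (fun t : ℝ≥0 => (t - s) + (s - t)) := by fun_prop
    simpa using this.tendsto s
  rw [ContinuousAt, tendsto_iff_dist_tendsto_zero]
  refine squeeze_zero (fun _ => dist_nonneg) (fun t => ?_) (hm.comp hd)
  simp only [Function.comp_apply, Real.dist_eq]
  rcases le_total s t with h | h
  · have := abs_semigroup_sub_le M f x s (t - s)
    rw [add_tsub_cancel_of_le h] at this
    simpa [tsub_eq_zero_of_le h] using this
  · have := abs_semigroup_sub_le M f x t (s - t)
    rw [add_tsub_cancel_of_le h, abs_sub_comm] at this
    simpa [tsub_eq_zero_of_le h] using this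

lemma integrableOn_exp_neg_mul {β : ℝ} (hβ : 0 < β) (c : ℝ) :
    IntegrableOn (fun s : ℝ => Real.exp (-β * s)) (Set.Ioi c) :=
  exp_neg_integrableOn_Ioi c hβ

lemma integrableOn_exp_mul_of_bound {β : ℝ} (hβ : 0 < β) (c : ℝ) {g : ℝ → ℝ} (hg : Measurable g)
    {C : ℝ} (hC : ∀ s, |g s| ≤ C) :
    IntegrableOn (fun s : ℝ => Real.exp (-β * s) * g s) (Set.Ioi c) :=
  Integrable.mul_bdd (integrableOn_exp_neg_mul hβ c) hg.aestronglyMeasurable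
    (ae_of_all _ hC)

/-- The resolvent identity: `f = ∫ e^{-β s} P_s(β f - 𝒬 f) ds`. -/
lemma integral_exp_mul_semigroup_gen (M : MarkovChain Q Ω) {β : ℝ} (hβ : 0 < β) (f : E → ℝ)
    (x : E) :
    ∫ s in Set.Ioi (0 : ℝ), Real.exp (-β * s) * semigroup M s.toNNReal (gen Q β f) x = -f x := by
  have hc : ∀ g : E → ℝ, Continuous (fun s : ℝ => semigroup M s.toNNReal g x) := fun g =>
    (continuous_semigroup M g x).comp continuous_real_toNNReal
  have he : Continuous (fun s : ℝ => Real.exp (-β * s)) := by fun_prop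
  have hI := integrableOn_exp_mul_of_bound hβ 0 (hc (gen Q β f)).measurable
    (fun s => abs_semigroup_le M (gen Q β f) s.toNNReal x)
  have h1 := intervalIntegral_tendsto_integral_Ioi 0 hI tendsto_id
  have h2 : ∀ T : ℝ, 0 ≤ T →
      ∫ s in (0 : ℝ)..T, Real.exp (-β * s) * semigroup M s.toNNReal (gen Q β f) x =
        Real.exp (-β * T) * semigroup M T.toNNReal f x - f x := by
    intro T hT
    -- Fundamental theorem of calculus for a continuous function with a right derivative.
    rw [intervalIntegral.integral_eq_sub_of_hasDeriv_right_of_le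
      (f := fun s : ℝ => Real.exp (-β * s) * semigroup M s.toNNReal f x) hT
      (he.mul (hc f)).continuousOn ?_ ?_]
    · simp [semigroup_zero]
    · intro s hs
      have h3 : HasDerivWithinAt (fun s : ℝ => Real.exp (-β * s)) (Real.exp (-β * s) * (-β))
          (Set.Ioi s) s := by
        have := ((hasDerivAt_id s).const_mul (-β)).exp
        simpa using this.hasDerivWithinAt
      have h4 := h3.mul ((hasDerivWithinAt_semigroup M f x hs.1.le).mono Set.Ioi_subset_Ici_self)
      refine h4.congr_deriv ?_
      rw [semigroup_gen]
      ring
    · exact (he.mul (hc (gen Q β f))).intervalIntegrable _ _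
  have h3 : Tendsto (fun T : ℝ => Real.exp (-β * T) * semigroup M T.toNNReal f x - f x) atTop
      (𝓝 (0 - f x)) := by
    refine Tendsto.sub_const ?_ _
    have h5 : Tendsto (fun T : ℝ => Real.exp (-β * T)) atTop (𝓝 0) :=
      Real.tendsto_exp_atBot.comp (tendsto_id.const_mul_atTop_of_neg (neg_neg_of_pos hβ))
    refine squeeze_zero_norm (a := fun T : ℝ => Real.exp (-β * T) * ∑ y, |f y|) (fun T => ?_)
      (by simpa using h5.mul_const (∑ y, |f y|))
    rw [norm_mul, Real.norm_of_nonneg (Real.exp_pos _).le]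
    exact mul_le_mul_of_nonneg_left (abs_semigroup_le M f _ x) (Real.exp_pos _).le
  have h6 := h3.congr' (f₂ := fun T : ℝ =>
    ∫ s in (0 : ℝ)..T, Real.exp (-β * s) * semigroup M s.toNNReal (gen Q β f) x) (by
      filter_upwards [eventually_ge_atTop 0] with T hT using (h2 T hT).symm)
  rw [tendsto_nhds_unique h1 h6, zero_sub]

end Semigroup

/-! ### Optional stopping by discretization from above. -/

section OptionalStopping

/-- The smallest multiple of `1 / (n + 1)` larger than `t`. -/
def gridAbove (n : ℕ) (t : ℝ≥0) : ℝ≥0 := (⌊t * (n + 1)⌋₊ + 1 : ℝ≥0) / (n + 1)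

lemma lt_gridAbove (n : ℕ) (t : ℝ≥0) : t < gridAbove n t := by
  rw [gridAbove, lt_div_iff₀ (by positivity)]
  exact Nat.lt_floor_add_one _

lemma gridAbove_le (n : ℕ) (t : ℝ≥0) : gridAbove n t ≤ t + 1 / (n + 1) := by
  rw [gridAbove, add_div]
  gcongr
  rw [div_le_iff₀ (by positivity)]
  exact Nat.floor_le zero_le

lemma tendsto_gridAbove (t : ℝ≥0) : Tendsto (fun n => gridAbove n t) atTop (𝓝[Set.Ici t] t) := by
  refine tendsto_nhdsWithin_iff.2 ⟨?_, Eventually.of_forall fun n => (lt_gridAbove n t).le⟩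
  refine tendsto_of_tendsto_of_tendsto_of_le_of_le tendsto_const_nhds ?_
    (fun n => (lt_gridAbove n t).le) (fun n => gridAbove_le n t)
  have : Tendsto (fun n : ℕ => (1 : ℝ≥0) / (n + 1)) atTop (𝓝 0) := by
    rw [← NNReal.tendsto_coe]
    simpa using tendsto_one_div_add_atTop_nhds_zero_nat (𝕜 := ℝ)
  simpa using this.const_add t

lemma measurable_gridAbove (n : ℕ) : Measurable (gridAbove n) := by
  unfold gridAbove
  have : Measurable fun t : ℝ≥0 => ⌊t * (n + 1)⌋₊ := Nat.measurable_floor.comp (by fun_prop)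
  have h2 : Measurable fun k : ℕ => (k : ℝ≥0) := measurable_of_countable _
  exact ((h2.comp this).add_const _).div_const _

lemma gridAbove_eq {n k : ℕ} {t : ℝ≥0} (h1 : (k : ℝ≥0) / (n + 1) ≤ t)
    (h2 : t < (k + 1 : ℝ≥0) / (n + 1)) : gridAbove n t = (k + 1 : ℝ≥0) / (n + 1) := by
  have : ⌊t * (n + 1)⌋₊ = k := by
    rw [Nat.floor_eq_iff zero_le]
    rw [div_le_iff₀ (by positivity)] at h1
    rw [lt_div_iff₀ (by positivity)] at h2
    exact ⟨h1, h2⟩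
  rw [gridAbove, this]

variable {Ω : Type*}

/-- A right-continuous process is jointly measurable. -/
lemma measurable_uncurry_of_rightContinuous [MeasurableSpace Ω] {Y : ℝ≥0 → Ω → ℝ} (hY : ∀ t, Measurable (Y t))
    (hr : ∀ ω t, ContinuousWithinAt (fun s => Y s ω) (Set.Ici t) t) :
    Measurable (Function.uncurry Y) := by
  refine measurable_of_tendsto_metrizable
    (f := fun (n : ℕ) (p : ℝ≥0 × Ω) => Y (gridAbove n p.1) p.2) (fun n => ?_) ?_
  · have key : ∀ (W : ℕ → Ω → ℝ) (e : ℝ≥0 → ℕ), (∀ k, Measurable (W k)) → Measurable e →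
        Measurable fun p : ℝ≥0 × Ω => W (e p.1) p.2 := fun W e hW he =>
      (measurable_from_prod_countable_right (f := fun p : ℕ × Ω => W p.1 p.2) hW).comp
        ((he.comp measurable_fst).prodMk measurable_snd)
    exact key (fun k => Y ((k + 1 : ℝ≥0) / (n + 1))) (fun t => ⌊t * (n + 1)⌋₊) (fun k => hY _)
      (Nat.measurable_floor.comp (by fun_prop))
  · rw [tendsto_pi_nhds]
    intro p
    exact (hr p.2 p.1).tendsto.comp (tendsto_gridAbove p.1)

/-- The value of the process `J` at the random time `σ`, equal to `0` where `σ = ∞`. -/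
def stopped (J : ℝ≥0 → Ω → ℝ) (σ : Ω → WithTop ℝ≥0) (ω : Ω) : ℝ :=
  WithTop.recTopCoe (C := fun _ => ℝ) 0 (fun t => J t ω) (σ ω)

lemma stopped_of_top {J : ℝ≥0 → Ω → ℝ} {σ : Ω → WithTop ℝ≥0} {ω : Ω} (h : σ ω = ⊤) :
    stopped J σ ω = 0 := by
  rw [stopped, h]
  rfl

lemma stopped_of_coe {J : ℝ≥0 → Ω → ℝ} {σ : Ω → WithTop ℝ≥0} {ω : Ω} {t : ℝ≥0} (h : σ ω = t) :
    stopped J σ ω = J t ω := by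
  rw [stopped, h]
  rfl

lemma abs_stopped_le {J : ℝ≥0 → Ω → ℝ} {σ : Ω → WithTop ℝ≥0} {C : ℝ} (hC : ∀ t ω, |J t ω| ≤ C)
    (ω : Ω) : |stopped J σ ω| ≤ C := by
  cases h : σ ω with
  | top =>
    rw [stopped_of_top h, abs_zero]
    exact (abs_nonneg _).trans (hC 0 ω)
  | coe t =>
    rw [stopped_of_coe h]
    exact hC t ω

lemma measurable_stopped [mΩ : MeasurableSpace Ω] {J : ℝ≥0 → Ω → ℝ} (hJ : Measurable (Function.uncurry J))
    {ℱ : Filtration ℝ≥0 mΩ} {σ : Ω → WithTop ℝ≥0} (hσ : IsStoppingTime ℱ σ) :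
    Measurable (stopped J σ) := by
  classical
  have h1 : stopped J σ = fun ω => if σ ω = ⊤ then 0 else J (σ ω).untopA ω := by
    ext ω
    cases h : σ ω with
    | top => rw [stopped_of_top h, if_pos rfl]
    | coe t =>
      rw [stopped_of_coe h, if_neg WithTop.coe_ne_top]
      rfl
  rw [h1]
  exact Measurable.ite (hσ.measurable' (measurableSet_singleton ⊤)) measurable_const
    (hJ.comp (hσ.measurable'.untopA.prodMk measurable_id))

lemma integrable_stopped [mΩ : MeasurableSpace Ω] {J : ℝ≥0 → Ω → ℝ} (hJ : Measurable (Function.uncurry J))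
    {C : ℝ} (hC : ∀ t ω, |J t ω| ≤ C) {ℱ : Filtration ℝ≥0 mΩ} {σ : Ω → WithTop ℝ≥0}
    (hσ : IsStoppingTime ℱ σ) (μ : Measure Ω) [IsFiniteMeasure μ] :
    Integrable (stopped J σ) μ :=
  Integrable.of_bound (measurable_stopped hJ hσ).aestronglyMeasurable C
    (ae_of_all _ (abs_stopped_le hC))

/-- Optional stopping for a bounded right-continuous process whose integrals over the events of
the present vanish. -/
lemma integral_stopped_eq_zero [mΩ : MeasurableSpace Ω] {J : ℝ≥0 → Ω → ℝ} (hJ : Measurable (Function.uncurry J))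
    {C : ℝ} (hC : ∀ t ω, |J t ω| ≤ C)
    (hr : ∀ ω t, ContinuousWithinAt (fun s => J s ω) (Set.Ici t) t)
    {ℱ : Filtration ℝ≥0 mΩ} {μ : Measure Ω} [IsFiniteMeasure μ]
    (hz : ∀ t A, MeasurableSet[ℱ t] A → ∫ ω in A, J t ω ∂μ = 0)
    {σ : Ω → WithTop ℝ≥0} (hσ : IsStoppingTime ℱ σ) : ∫ ω, stopped J σ ω ∂μ = 0 := by
  -- `J` need not be adapted: only its integrals over present events matter. Stopping at the next
  -- grid point after `σ` takes countably many values, and right-continuity recovers `σ` in the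
  -- limit.
  let Y : ℕ → Ω → ℝ := fun n => stopped (fun t => J (gridAbove n t)) σ
  have hmeas : ∀ n, Measurable (Y n) := fun n => by
    refine measurable_stopped ?_ hσ
    exact hJ.comp (((measurable_gridAbove n).comp measurable_fst).prodMk measurable_snd)
  have hbound : ∀ n ω, |Y n ω| ≤ C := fun n => abs_stopped_le fun t ω => hC _ ω
  have hYz : ∀ n, ∫ ω, Y n ω ∂μ = 0 := by
    intro n
    -- The event `k/(n+1) ≤ σ < (k+1)/(n+1)`. It is already known at time `(k+1)/(n+1)`, the grid
    -- point at which `J` is evaluated on it.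
    let A : ℕ → Set Ω := fun k =>
      {ω | σ ω < (((k + 1 : ℝ≥0) / (n + 1) : ℝ≥0) : WithTop ℝ≥0)} \
        {ω | σ ω < (((k : ℝ≥0) / (n + 1) : ℝ≥0) : WithTop ℝ≥0)}
    have hA : ∀ k : ℕ, MeasurableSet[ℱ ((k + 1 : ℝ≥0) / (n + 1))] (A k) := fun k =>
      (hσ.measurableSet_lt _).diff (hσ.measurableSet_lt_le (by gcongr; exact le_self_add))
    have hAm : ∀ k, MeasurableSet (A k) := fun k => ℱ.le _ _ (hA k)
    have hAY : ∀ k, ∀ ω ∈ A k, gridAbove n (σ ω).untopA = (k + 1 : ℝ≥0) / (n + 1) ∧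
        Y n ω = J ((k + 1 : ℝ≥0) / (n + 1)) ω := by
      intro k ω hω
      obtain ⟨h1, h2⟩ := hω
      replace h1 : σ ω < (((k + 1 : ℝ≥0) / (n + 1) : ℝ≥0) : WithTop ℝ≥0) := h1
      replace h2 : (((k : ℝ≥0) / (n + 1) : ℝ≥0) : WithTop ℝ≥0) ≤ σ ω := not_lt.1 h2
      cases h : σ ω with
      | top => exact absurd (h ▸ h1) not_top_lt
      | coe t =>
        rw [h] at h1 h2
        have := gridAbove_eq (WithTop.coe_le_coe.1 h2) (WithTop.coe_lt_coe.1 h1)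
        refine ⟨this, ?_⟩
        simp only [Y]
        rw [stopped_of_coe h, this]
    have hdisj : Pairwise (Function.onFun Disjoint A) := by
      intro k l hkl
      refine Set.disjoint_left.2 fun ω hk hl => hkl ?_
      have h1 := (hAY k ω hk).1.symm.trans (hAY l ω hl).1
      rw [div_left_inj' (by positivity)] at h1
      exact_mod_cast add_right_cancel h1
    have hcompl : ∀ ω, ω ∉ ⋃ k, A k → Y n ω = 0 := by
      intro ω hω
      cases h : σ ω with
      | top => exact stopped_of_top h
      | coe t =>
        have h1 : σ ω < (gridAbove n t : WithTop ℝ≥0) := by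
          rw [h]
          exact WithTop.coe_lt_coe.2 (lt_gridAbove n t)
        have h2 : (((⌊t * (n + 1)⌋₊ : ℝ≥0) / (n + 1) : ℝ≥0) : WithTop ℝ≥0) ≤ σ ω := by
          rw [h]
          refine WithTop.coe_le_coe.2 ?_
          rw [div_le_iff₀ (by positivity)]
          exact Nat.floor_le zero_le
        have h3 : ω ∈ A ⌊t * (n + 1)⌋₊ := ⟨h1, not_lt.2 h2⟩
        exact absurd (Set.mem_iUnion_of_mem _ h3) hω
    rw [← setIntegral_eq_integral_of_forall_compl_eq_zero hcompl,
      integral_iUnion hAm hdisj (Integrable.of_bound (hmeas n).aestronglyMeasurable C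
        (ae_of_all _ (hbound n))).integrableOn]
    refine (tsum_congr fun k => ?_).trans tsum_zero
    rw [setIntegral_congr_fun (hAm k) fun ω hω => (hAY k ω hω).2]
    exact hz _ _ (hA k)
  have hlim : ∀ ω, Tendsto (fun n => Y n ω) atTop (𝓝 (stopped J σ ω)) := by
    intro ω
    cases h : σ ω with
    | top =>
      simp only [Y]
      simp_rw [stopped_of_top h]
      exact tendsto_const_nhds
    | coe t =>
      simp only [Y]
      simp_rw [stopped_of_coe h]
      exact (hr ω t).tendsto.comp (tendsto_gridAbove t)
  have := tendsto_integral_of_dominated_convergence (μ := μ) (fun _ => C)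
    (fun n => (hmeas n).aestronglyMeasurable) (integrable_const C)
    (fun n => ae_of_all _ (hbound n)) (ae_of_all _ hlim)
  simp_rw [hYz] at this
  exact tendsto_nhds_unique this tendsto_const_nhds

end OptionalStopping

/-! ### Dynkin's formula at stopping times. -/

section Dynkin

variable {E : Type*} [Fintype E] [TopologicalSpace E] [DiscreteTopology E]
  [MeasurableSpace E] [BorelSpace E] {Q : Matrix E E ℝ} {Ω : Type*} [MeasurableSpace Ω]

lemma continuousWithinAt_comp_X (M : MarkovChain Q Ω) (g : E → ℝ) (ω : Ω) (t : ℝ≥0) :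
    ContinuousWithinAt (fun s => g (M.X s ω)) (Set.Ici t) t :=
  (continuous_of_discreteTopology (f := g)).continuousAt.comp_continuousWithinAt
    (M.right_cont ω t)

lemma measurable_uncurry_comp_X (M : MarkovChain Q Ω) (g : E → ℝ) :
    Measurable (Function.uncurry fun t ω => g (M.X t ω)) :=
  measurable_uncurry_of_rightContinuous
    (fun t => (measurable_of_finite g).comp (M.measurable_X t)) (continuousWithinAt_comp_X M g)

/-- The integrand `e^{-β s} g(X_s)`, as a function of a real time `s`. -/
def discountedPath (M : MarkovChain Q Ω) (β : ℝ) (g : E → ℝ) (ω : Ω) (s : ℝ) : ℝ :=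
  Real.exp (-β * s) * g (M.X s.toNNReal ω)

lemma measurable_uncurry_discountedPath (M : MarkovChain Q Ω) (β : ℝ) (g : E → ℝ) :
    Measurable (Function.uncurry (discountedPath M β g)) := by
  refine Measurable.mul (by fun_prop) ?_
  exact (measurable_uncurry_comp_X M g).comp
    ((measurable_real_toNNReal.comp measurable_snd).prodMk measurable_fst)

lemma integrableOn_discountedPath (M : MarkovChain Q Ω) {β : ℝ} (hβ : 0 < β) (g : E → ℝ) (ω : Ω)
    (c : ℝ) : IntegrableOn (discountedPath M β g ω) (Set.Ioi c) :=
  integrableOn_exp_mul_of_bound hβ c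
    (((measurable_uncurry_comp_X M g).comp
      (measurable_real_toNNReal.prodMk measurable_const)))
    fun _ => norm_apply_le_sum g _

lemma abs_discountedPath_le (M : MarkovChain Q Ω) (β : ℝ) (g : E → ℝ) (ω : Ω) (s : ℝ) :
    |discountedPath M β g ω s| ≤ Real.exp (-β * s) * ∑ y, |g y| := by
  rw [discountedPath, abs_mul, abs_of_pos (Real.exp_pos _)]
  exact mul_le_mul_of_nonneg_left (norm_apply_le_sum g _) (Real.exp_pos _).le

/-- The remaining discounted integral `∫_t^∞ e^{-β s} g(X_s) ds`. -/
def tailIntegral (M : MarkovChain Q Ω) (β : ℝ) (g : E → ℝ) (t : ℝ≥0) (ω : Ω) : ℝ :=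
  ∫ s in Set.Ioi (t : ℝ), discountedPath M β g ω s

lemma measurable_tailIntegral (M : MarkovChain Q Ω) (β : ℝ) (g : E → ℝ) (t : ℝ≥0) :
    Measurable (tailIntegral M β g t) :=
  (StronglyMeasurable.integral_prod_right
    (measurable_uncurry_discountedPath M β g).stronglyMeasurable).measurable

lemma abs_tailIntegral_le (M : MarkovChain Q Ω) {β : ℝ} (hβ : 0 < β) (g : E → ℝ) (t : ℝ≥0)
    (ω : Ω) :
    |tailIntegral M β g t ω| ≤ ∫ s in Set.Ioi (0 : ℝ), Real.exp (-β * s) * ∑ y, |g y| := by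
  have hi : ∀ c : ℝ, IntegrableOn (fun s : ℝ => Real.exp (-β * s) * ∑ y, |g y|) (Set.Ioi c) :=
    fun c => (integrableOn_exp_neg_mul hβ c).mul_const _
  refine (norm_integral_le_of_norm_le (hi t)
    (ae_of_all _ fun s => (Real.norm_eq_abs _).trans_le (abs_discountedPath_le M β g ω s))).trans ?_
  exact setIntegral_mono_set (hi 0) (ae_of_all _ fun s => by positivity)
    (Set.Ioi_subset_Ioi t.2).eventuallyLE

lemma tailIntegral_zero_sub (M : MarkovChain Q Ω) {β : ℝ} (hβ : 0 < β) (g : E → ℝ) (t : ℝ≥0)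
    (ω : Ω) :
    tailIntegral M β g 0 ω - tailIntegral M β g t ω =
      ∫ s in (0 : ℝ)..t, discountedPath M β g ω s :=
  intervalIntegral.integral_Ioi_sub_Ioi' (integrableOn_discountedPath M hβ g ω _)
    (integrableOn_discountedPath M hβ g ω _)

lemma continuous_tailIntegral (M : MarkovChain Q Ω) {β : ℝ} (hβ : 0 < β) (g : E → ℝ) (ω : Ω) :
    Continuous (fun t => tailIntegral M β g t ω) := by
  have h1 : ∀ t, tailIntegral M β g t ω = tailIntegral M β g 0 ω -
      ∫ s in (0 : ℝ)..t, discountedPath M β g ω s := fun t => by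
    rw [← tailIntegral_zero_sub M hβ, sub_sub_cancel]
  rw [funext h1]
  refine continuous_const.sub ((intervalIntegral.continuous_primitive (fun a b => ?_) 0).comp
    NNReal.continuous_coe)
  rw [intervalIntegrable_iff]
  exact (integrableOn_discountedPath M hβ g ω (min a b)).mono_set Set.Ioc_subset_Ioi_self

/-- After Fubini and the shift `s = t + u`, the Markov property at time `t` turns the inner
expectation into the semigroup, and the resolvent identity evaluates the integral in `u`. The sum of
the two integrands thus satisfies the hypothesis of `integral_stopped_eq_zero`. -/
lemma setIntegral_tailIntegral (M : MarkovChain Q Ω) {β : ℝ} (hβ : 0 < β) (f : E → ℝ) (x : E)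
    (t : ℝ≥0) {A : Set Ω} (hA : MeasurableSet[Filtration.natural M.X M.meas t] A) :
    ∫ ω in A, tailIntegral M β (gen Q β f) t ω ∂(M.P x) =
      -∫ ω in A, Real.exp (-β * t) * f (M.X t ω) ∂(M.P x) := by
  have hint : Integrable (Function.uncurry (discountedPath M β (gen Q β f)))
      (((M.P x).restrict A).prod (volume.restrict (Set.Ioi (t : ℝ)))) := by
    refine Integrable.mono' (g := fun p : Ω × ℝ => 1 * (Real.exp (-β * p.2) * ∑ y, |gen Q β f y|))
      ?_ (measurable_uncurry_discountedPath M β _).aestronglyMeasurable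
      (ae_of_all _ fun p => by
        rw [one_mul]
        exact abs_discountedPath_le M β _ p.1 p.2)
    exact Integrable.mul_prod (integrable_const (1 : ℝ))
      ((integrableOn_exp_neg_mul hβ (t : ℝ)).mul_const _)
  simp only [tailIntegral]
  rw [integral_integral_swap hint,
    ← (measurePreserving_add_left volume (t : ℝ)).setIntegral_preimage_emb
      (measurableEmbedding_addLeft (t : ℝ))]
  rw [Set.preimage_const_add_Ioi, sub_self]
  have h1 : ∀ u ∈ Set.Ioi (0 : ℝ),
      ∫ ω in A, discountedPath M β (gen Q β f) ω (t + u) ∂(M.P x) =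
        ∑ z, (M.P x).real (A ∩ M.X t ⁻¹' {z}) * Real.exp (-β * t) *
          (Real.exp (-β * u) * semigroup M u.toNNReal (gen Q β f) z) := by
    intro u hu
    simp only [discountedPath]
    rw [integral_const_mul, Real.toNNReal_add t.coe_nonneg (le_of_lt hu), Real.toNNReal_coe,
      setIntegral_comp_X_add M _ t _ x hA, Finset.mul_sum]
    refine Finset.sum_congr rfl fun z _ => ?_
    rw [mul_add, Real.exp_add]
    ring
  rw [setIntegral_congr_fun measurableSet_Ioi h1, integral_finsetSum]
  · simp_rw [integral_const_mul, integral_exp_mul_semigroup_gen M hβ]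
    rw [setIntegral_comp_X, Finset.mul_sum, ← Finset.sum_neg_distrib]
    refine Finset.sum_congr rfl fun z _ => by ring
  · intro z _
    refine Integrable.const_mul ?_ _
    exact integrableOn_exp_mul_of_bound hβ 0
      ((continuous_semigroup M _ z).comp continuous_real_toNNReal).measurable
      (fun s => abs_semigroup_le M _ s.toNNReal z)

lemma discounted_eq_stopped (M : MarkovChain Q Ω) (β : ℝ) (f : E → ℝ) (σ : Ω → WithTop ℝ≥0)
    (ω : Ω) :
    discounted M β f σ ω = stopped (fun t ω => Real.exp (-β * t) * f (M.X t ω)) σ ω := by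
  unfold discounted stopped
  cases σ ω <;> rfl

lemma discounted_of_top {M : MarkovChain Q Ω} {β : ℝ} {f : E → ℝ} {σ : Ω → WithTop ℝ≥0} {ω : Ω}
    (h : σ ω = ⊤) : discounted M β f σ ω = 0 := by
  rw [discounted_eq_stopped, stopped_of_top h]

lemma discounted_of_coe {M : MarkovChain Q Ω} {β : ℝ} {f : E → ℝ} {σ : Ω → WithTop ℝ≥0} {ω : Ω}
    {t : ℝ≥0} (h : σ ω = t) : discounted M β f σ ω = Real.exp (-β * t) * f (M.X t ω) := by
  rw [discounted_eq_stopped, stopped_of_coe h]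

lemma measurable_uncurry_exp_mul_comp_X (M : MarkovChain Q Ω) (β : ℝ) (f : E → ℝ) :
    Measurable (Function.uncurry fun (t : ℝ≥0) ω => Real.exp (-β * t) * f (M.X t ω)) :=
  Measurable.mul (by fun_prop) (measurable_uncurry_comp_X M f)

lemma abs_exp_mul_comp_X_le (M : MarkovChain Q Ω) {β : ℝ} (hβ : 0 < β) (f : E → ℝ) (t : ℝ≥0)
    (ω : Ω) : |Real.exp (-β * t) * f (M.X t ω)| ≤ ∑ y, |f y| := by
  rw [abs_mul, abs_of_pos (Real.exp_pos _)]
  have : Real.exp (-β * t) ≤ 1 := Real.exp_le_one_iff.2 (by nlinarith [t.2, hβ, t.coe_nonneg])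
  exact (mul_le_of_le_one_left (abs_nonneg _) this).trans (norm_apply_le_sum f _)

lemma integrable_discounted (M : MarkovChain Q Ω) {β : ℝ} (hβ : 0 < β) (f : E → ℝ)
    (σ : StoppingTime M) (x : E) : Integrable (discounted M β f σ.1) (M.P x) := by
  rw [funext (discounted_eq_stopped M β f σ.1)]
  exact integrable_stopped (measurable_uncurry_exp_mul_comp_X M β f)
    (abs_exp_mul_comp_X_le M hβ f) σ.2 _

/-- Dynkin's formula, with the time integral written as the integral from the stopping time on. -/
lemma integral_discounted_eq (M : MarkovChain Q Ω) {β : ℝ} (hβ : 0 < β) (f : E → ℝ)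
    (σ : StoppingTime M) (x : E) :
    ∫ ω, discounted M β f σ.1 ω ∂(M.P x) =
      -∫ ω, stopped (tailIntegral M β (gen Q β f)) σ.1 ω ∂(M.P x) := by
  set Y : ℝ≥0 → Ω → ℝ := fun t ω => Real.exp (-β * t) * f (M.X t ω)
  set Z := tailIntegral M β (gen Q β f)
  have hZ : Measurable (Function.uncurry Z) :=
    measurable_uncurry_of_rightContinuous (measurable_tailIntegral M β _)
      fun ω t => (continuous_tailIntegral M hβ _ ω).continuousWithinAt
  have hY := measurable_uncurry_exp_mul_comp_X M β f
  have hYC := abs_exp_mul_comp_X_le M hβ f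
  have hZC := abs_tailIntegral_le M hβ (gen Q β f)
  have h0 : ∫ ω, stopped (fun t ω => Y t ω + Z t ω) σ.1 ω ∂(M.P x) = 0 := by
    refine integral_stopped_eq_zero (hY.add hZ)
      (fun t ω => (abs_add_le _ _).trans (add_le_add (hYC t ω) (hZC t ω))) ?_ ?_ σ.2
    · intro ω t
      refine ContinuousWithinAt.add (ContinuousWithinAt.mul ?_ (continuousWithinAt_comp_X M f ω t))
        (continuous_tailIntegral M hβ _ ω).continuousWithinAt
      have : Continuous fun s : ℝ≥0 => Real.exp (-β * s) := by fun_prop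
      exact this.continuousWithinAt
    · intro t A hA
      have hYi : Integrable (Y t) (M.P x) := (integrable_comp_X M f t x).const_mul _
      have hZi : Integrable (Z t) (M.P x) :=
        Integrable.of_bound (measurable_tailIntegral M β _ t).aestronglyMeasurable _
          (ae_of_all _ (hZC t))
      rw [integral_add hYi.integrableOn hZi.integrableOn, setIntegral_tailIntegral M hβ f x t hA]
      exact add_neg_cancel _
  have h1 : ∀ ω, stopped (fun t ω => Y t ω + Z t ω) σ.1 ω = stopped Y σ.1 ω + stopped Z σ.1 ω := by
    intro ω
    cases h : σ.1 ω with
    | top => simp only [stopped_of_top h, add_zero]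
    | coe t => simp only [stopped_of_coe h]
  simp_rw [h1] at h0
  rw [integral_add (integrable_stopped hY hYC σ.2 _) (integrable_stopped hZ hZC σ.2 _)] at h0
  simp_rw [discounted_eq_stopped]
  exact eq_neg_of_add_eq_zero_left h0

lemma integral_tailIntegral_zero (M : MarkovChain Q Ω) {β : ℝ} (hβ : 0 < β) (f : E → ℝ) (x : E) :
    ∫ ω, tailIntegral M β (gen Q β f) 0 ω ∂(M.P x) = -f x := by
  have h := setIntegral_tailIntegral M hβ f x 0 (A := Set.univ)
    (@MeasurableSet.univ _ (Filtration.natural M.X M.meas 0))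
  simp only [Measure.restrict_univ] at h
  rw [h, integral_congr_ae (g := fun _ => f x)]
  · simp
  · filter_upwards [M.start x] with ω hω
    simp [hω]

/-- If `𝒬[f] - β f ≤ 0` along the paths of the chain before the stopping time `σ`, then
`𝔼_x[e^{-β σ} f(X_σ)] ≤ f(x)`. -/
lemma integral_discounted_le (M : MarkovChain Q Ω) {β : ℝ} (hβ : 0 < β) (f : E → ℝ)
    (σ : StoppingTime M) (x : E)
    (h : ∀ ω (s : ℝ≥0), (s : WithTop ℝ≥0) < σ.1 ω → gen Q β f (M.X s ω) ≤ 0) :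
    ∫ ω, discounted M β f σ.1 ω ∂(M.P x) ≤ f x := by
  have hZC := abs_tailIntegral_le M hβ (gen Q β f)
  have hZ : Measurable (Function.uncurry (tailIntegral M β (gen Q β f))) :=
    measurable_uncurry_of_rightContinuous (measurable_tailIntegral M β _)
      fun ω t => (continuous_tailIntegral M hβ _ ω).continuousWithinAt
  rw [integral_discounted_eq M hβ, neg_le, ← integral_tailIntegral_zero M hβ f x]
  -- The tail from `0` minus the tail from `σ` is the integral of `e^{-βs} (𝒬[f] - βf)(X_s)` before
  -- `σ`, which is nonpositive path by path.
  refine integral_mono (Integrable.of_bound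
    (measurable_tailIntegral M β _ 0).aestronglyMeasurable _ (ae_of_all _ (hZC 0)))
    (integrable_stopped hZ hZC σ.2 _) fun ω => ?_
  cases hσ : σ.1 ω with
  | top =>
    simp only [stopped_of_top hσ]
    refine setIntegral_nonpos measurableSet_Ioi fun s _ => ?_
    exact mul_nonpos_of_nonneg_of_nonpos (Real.exp_pos _).le
      (h ω _ (hσ ▸ WithTop.coe_lt_top _))
  | coe t =>
    simp only [stopped_of_coe hσ]
    rw [← sub_nonpos, tailIntegral_zero_sub M hβ, intervalIntegral.integral_of_le t.coe_nonneg,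
      integral_Ioc_eq_integral_Ioo]
    refine setIntegral_nonpos measurableSet_Ioo fun s hs => ?_
    refine mul_nonpos_of_nonneg_of_nonpos (Real.exp_pos _).le (h ω _ ?_)
    rw [hσ]
    exact WithTop.coe_lt_coe.2 ((Real.toNNReal_lt_iff_lt_coe hs.1.le).2 hs.2)

lemma gen_neg {ι : Type*} [Fintype ι] (Q : Matrix ι ι ℝ) (β : ℝ) (f : ι → ℝ) (x : ι) :
    gen Q β (-f) x = -gen Q β f x := by
  simp only [gen, Matrix.mulVec_neg, Pi.neg_apply]
  ring

/-- The supersolution inequality is applied to both `f` and `-f`. -/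
lemma integral_discounted_eq_of_gen_eq_zero (M : MarkovChain Q Ω) {β : ℝ} (hβ : 0 < β)
    (f : E → ℝ) (σ : StoppingTime M) (x : E)
    (h : ∀ ω (s : ℝ≥0), (s : WithTop ℝ≥0) < σ.1 ω → gen Q β f (M.X s ω) = 0) :
    ∫ ω, discounted M β f σ.1 ω ∂(M.P x) = f x := by
  refine le_antisymm (integral_discounted_le M hβ f σ x fun ω s hs => (h ω s hs).le) ?_
  have h1 := integral_discounted_le M hβ (-f) σ x fun ω s hs => by
    rw [gen_neg, h ω s hs, neg_zero]
  have h2 : ∀ ω, discounted M β (-f) σ.1 ω = -discounted M β f σ.1 ω := by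
    intro ω
    cases hσ : σ.1 ω with
    | top => simp only [discounted_of_top hσ, neg_zero]
    | coe t => simp only [discounted_of_coe hσ, Pi.neg_apply, mul_neg]
  simp_rw [h2] at h1
  rw [integral_neg, Pi.neg_apply] at h1
  exact neg_le_neg_iff.1 h1

end Dynkin

/-! ### Hitting times and verification of payoffs. -/

section Hitting

variable {E : Type*} [Fintype E] [TopologicalSpace E] [DiscreteTopology E]
  [MeasurableSpace E] [BorelSpace E] {Q : Matrix E E ℝ} {Ω : Type*} [MeasurableSpace Ω]

/-- The chain stays for some time in each state it visits. -/
lemma exists_forall_Ico_X_eq (M : MarkovChain Q Ω) (ω : Ω) (t : ℝ≥0) :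
    ∃ u > t, ∀ s ∈ Set.Ico t u, M.X s ω = M.X t ω := by
  have h := (M.right_cont ω t).tendsto
  rw [nhds_discrete, tendsto_pure] at h
  obtain ⟨u, hu, hs⟩ := mem_nhdsGE_iff_exists_Ico_subset.1 h
  exact ⟨u, hu, fun s hs' => hs hs'⟩

lemma X_notMem_of_lt_hit {M : MarkovChain Q Ω} {A : Set E} {ω : Ω} {s : ℝ≥0}
    (h : (s : WithTop ℝ≥0) < hit M A ω) : M.X s ω ∉ A :=
  notMem_of_lt_hittingAfter h zero_le

lemma hit_le_of_X_mem {M : MarkovChain Q Ω} {A : Set E} {ω : Ω} {s : ℝ≥0} (h : M.X s ω ∈ A) :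
    hit M A ω ≤ s :=
  not_lt.1 fun h' => X_notMem_of_lt_hit h' h

/-- The infimum is attained: a path outside `A` at time `t` stays outside on some `[t, u)`, so the
infimum of visit times could not be `t`. -/
lemma X_mem_of_hit_eq {M : MarkovChain Q Ω} {A : Set E} {ω : Ω} {t : ℝ≥0}
    (h : hit M A ω = t) : M.X t ω ∈ A := by
  by_contra hA
  obtain ⟨u, hu, hs⟩ := exists_forall_Ico_X_eq M ω t
  have hex : ∃ j, 0 ≤ j ∧ M.X j ω ∈ A := by
    by_contra hne
    have h' : hit M A ω = ⊤ := hittingAfter_eq_top_iff.2 fun j hj hj' => hne ⟨j, hj, hj'⟩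
    exact WithTop.coe_ne_top (h.symm.trans h')
  have hinf : sInf {i : ℝ≥0 | 0 ≤ i ∧ M.X i ω ∈ A} = t := by
    have h1 : hit M A ω = ((sInf {i : ℝ≥0 | 0 ≤ i ∧ M.X i ω ∈ A} : ℝ≥0) : WithTop ℝ≥0) := by
      classical
      unfold hit hittingAfter
      exact if_pos hex
    exact WithTop.coe_injective (h1.symm.trans h)
  obtain ⟨s, hsA, hsu⟩ := exists_lt_of_csInf_lt hex (hinf.trans_lt hu)
  have hts : t ≤ s := hinf ▸ csInf_le (OrderBot.bddBelow _) hsA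
  exact hA (hs s ⟨hts, hsu⟩ ▸ hsA.2)

lemma isStoppingTime_hit (M : MarkovChain Q Ω) (A : Set E) :
    IsStoppingTime (Filtration.natural M.X M.meas) (hit M A) := by
  intro t
  obtain ⟨D, hDc, hDd⟩ := TopologicalSpace.exists_countable_dense ℝ≥0
  -- A visit before `t` lasts long enough to be seen at a time of the dense set. A first visit
  -- exactly at `t` may not be, hence the inserted point `t`.
  have heq : {ω | hit M A ω ≤ t} = ⋃ q ∈ insert t D ∩ Set.Iic t, M.X q ⁻¹' A := by
    ext ω
    rw [Set.mem_iUnion₂]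
    constructor
    · intro h
      replace h : hit M A ω ≤ (t : WithTop ℝ≥0) := h
      cases hs : hit M A ω with
      | top => exact absurd (hs ▸ h) (not_le.2 (WithTop.coe_lt_top t))
      | coe s =>
        have hst : s ≤ t := WithTop.coe_le_coe.1 (hs ▸ h)
        have hX := X_mem_of_hit_eq hs
        rcases hst.eq_or_lt with rfl | hlt
        · exact ⟨s, ⟨Set.mem_insert _ _, Set.mem_Iic.2 le_rfl⟩, hX⟩
        · obtain ⟨u, hu, hc⟩ := exists_forall_Ico_X_eq M ω s
          obtain ⟨q, hqD, hq1, hq2⟩ := hDd.exists_between (lt_min hu hlt)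
          refine ⟨q, ⟨Set.mem_insert_of_mem _ hqD, (hq2.trans_le (min_le_right _ _)).le⟩, ?_⟩
          rw [Set.mem_preimage, hc q ⟨hq1.le, hq2.trans_le (min_le_left _ _)⟩]
          exact hX
    · rintro ⟨q, ⟨-, hqt⟩, hq⟩
      exact (hit_le_of_X_mem hq).trans (WithTop.coe_le_coe.2 hqt)
  rw [heq]
  refine MeasurableSet.biUnion ((hDc.insert t).mono Set.inter_subset_left) fun q hq => ?_
  exact ((Filtration.stronglyAdapted_natural M.meas q).mono
    ((Filtration.natural M.X M.meas).mono hq.2)).measurable A.toFinite.measurableSet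

/-- The hitting time of a set, as a stopping time. -/
def hitTime (M : MarkovChain Q Ω) (A : Set E) : StoppingTime M := ⟨hit M A, isStoppingTime_hit M A⟩

/-- The minimum of two stopping times. -/
def StoppingTime.min {M : MarkovChain Q Ω} (τ γ : StoppingTime M) : StoppingTime M :=
  ⟨fun ω => Min.min (τ.1 ω) (γ.1 ω), τ.2.min γ.2⟩

/-- The payoff is pointwise at most the discounted value of `f` at `min(τ, h(S))`. Before that time
the chain is off `S`, so `f` only has to be a supersolution there. -/
lemma payoff_le_of_supersolution (M : MarkovChain Q Ω) {β : ℝ} (hβ : 0 < β) {ψ φ f : E → ℝ}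
    (hψ : ∀ x, 0 ≤ ψ x) (hφ : ∀ x, 0 ≤ φ x) {S : Set E} (hψf : ∀ x, ψ x ≤ f x)
    (hφf : ∀ x ∈ S, φ x ≤ f x) (hgen : ∀ x ∉ S, gen Q β f x ≤ 0) (τ : StoppingTime M) (x : E) :
    payoff M β ψ φ τ.1 (hit M S) x ≤ f x := by
  have hpos : ∀ {g : E → ℝ}, (∀ x, 0 ≤ g x) → ∀ σ ω, 0 ≤ discounted M β g σ ω := by
    intro g hg σ ω
    cases h : σ ω with
    | top => rw [discounted_of_top h]
    | coe t =>
      rw [discounted_of_coe h]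
      exact mul_nonneg (Real.exp_pos _).le (hg _)
  refine (integral_mono_of_nonneg (ae_of_all _ fun ω => ?_)
    (integrable_discounted M hβ f (τ.min (hitTime M S)) x) (ae_of_all _ fun ω => ?_)).trans
    (integral_discounted_le M hβ f (τ.min (hitTime M S)) x fun ω s hs =>
      hgen _ (X_notMem_of_lt_hit (hs.trans_le (min_le_right _ _))))
  · simp only [Pi.zero_apply]
    split_ifs
    · exact hpos hψ _ _
    · exact hpos hφ _ _
  · split_ifs with h
    · have hm : (τ.min (hitTime M S)).1 ω = τ.1 ω := min_eq_left h
      cases hτ : τ.1 ω with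
      | top => rw [discounted_of_top hτ, discounted_of_top (hm.trans hτ)]
      | coe t =>
        rw [discounted_of_coe hτ, discounted_of_coe (hm.trans hτ)]
        exact mul_le_mul_of_nonneg_left (hψf _) (Real.exp_pos _).le
    · have hm : (τ.min (hitTime M S)).1 ω = hit M S ω := min_eq_right (not_le.1 h).le
      cases hγ : hit M S ω with
      | top => rw [discounted_of_top hγ, discounted_of_top (hm.trans hγ)]
      | coe t =>
        rw [discounted_of_coe hγ, discounted_of_coe (hm.trans hγ)]
        exact mul_le_mul_of_nonneg_left (hφf _ (X_mem_of_hit_eq hγ)) (Real.exp_pos _).le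

/-- Here the payoff equals the discounted value of `f` at the first entry into `D ∪ S`, and Dynkin's
formula holds with equality. -/
lemma payoff_hit_eq_of_dirichlet (M : MarkovChain Q Ω) {β : ℝ} (hβ : 0 < β) {ψ φ f : E → ℝ}
    {D S : Set E} (hD : ∀ x ∈ D, f x = ψ x) (hS : ∀ x ∈ S, f x = φ x)
    (hgen : ∀ x ∉ D ∪ S, gen Q β f x = 0) (x : E) :
    payoff M β ψ φ (hit M D) (hit M S) x = f x := by
  rw [← integral_discounted_eq_of_gen_eq_zero M hβ f ((hitTime M D).min (hitTime M S)) x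
    fun ω s hs => hgen _ fun h => h.elim
      (X_notMem_of_lt_hit (hs.trans_le (min_le_left _ _)))
      (X_notMem_of_lt_hit (hs.trans_le (min_le_right _ _)))]
  refine integral_congr_ae (ae_of_all _ fun ω => ?_)
  simp only
  split_ifs with h
  · have hm : ((hitTime M D).min (hitTime M S)).1 ω = hit M D ω := min_eq_left h
    cases hτ : hit M D ω with
    | top => rw [discounted_of_top hτ, discounted_of_top (hm.trans hτ)]
    | coe t =>
      rw [discounted_of_coe hτ, discounted_of_coe (hm.trans hτ), hD _ (X_mem_of_hit_eq hτ)]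
  · have hm : ((hitTime M D).min (hitTime M S)).1 ω = hit M S ω := min_eq_right (not_le.1 h).le
    cases hγ : hit M S ω with
    | top => rw [discounted_of_top hγ, discounted_of_top (hm.trans hγ)]
    | coe t =>
      rw [discounted_of_coe hγ, discounted_of_coe (hm.trans hγ), hS _ (X_mem_of_hit_eq hγ)]

end Hitting

/-! ### Maximum principle and Dirichlet problem for `𝒬 - β`. -/

section Deterministic

variable {E : Type*} [Fintype E] {Q : Matrix E E ℝ}

lemma gen_add (Q : Matrix E E ℝ) (β : ℝ) (f g : E → ℝ) (x : E) :
    gen Q β (f + g) x = gen Q β f x + gen Q β g x := by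
  simp only [gen, Matrix.mulVec_add, Pi.add_apply]
  ring

lemma gen_smul (Q : Matrix E E ℝ) (β c : ℝ) (f : E → ℝ) (x : E) :
    gen Q β (c • f) x = c * gen Q β f x := by
  simp only [gen, Matrix.mulVec_smul, Pi.smul_apply, smul_eq_mul]
  ring

lemma gen_sub (Q : Matrix E E ℝ) (β : ℝ) (f g : E → ℝ) (x : E) :
    gen Q β (f - g) x = gen Q β f x - gen Q β g x := by
  rw [sub_eq_add_neg, gen_add, gen_neg, sub_eq_add_neg]

lemma IsMarkovGenerator.mulVec_apply (hQ : IsMarkovGenerator Q) (f : E → ℝ) (x : E) :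
    (Q *ᵥ f) x = ∑ y, Q x y * (f y - f x) := by
  simp only [Matrix.mulVec, dotProduct, mul_sub, Finset.sum_sub_distrib, ← Finset.sum_mul,
    hQ.row_sum, zero_mul, sub_zero]

lemma IsMarkovGenerator.mulVec_nonpos (hQ : IsMarkovGenerator Q) {f : E → ℝ} {x : E}
    (h : ∀ y, f y ≤ f x) : (Q *ᵥ f) x ≤ 0 := by
  rw [hQ.mulVec_apply]
  refine Finset.sum_nonpos fun y _ => ?_
  rcases eq_or_ne x y with rfl | hxy
  · simp
  · exact mul_nonpos_of_nonneg_of_nonpos (hQ.off_diag x y hxy) (sub_nonpos.2 (h y))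

/-- The difference `f - g` has a maximum, equal to `0`, at `x`, where only the nonnegative
off-diagonal rates contribute. -/
lemma gen_le_gen_of_eq (hQ : IsMarkovGenerator Q) (β : ℝ) {f g : E → ℝ} (hfg : ∀ y, f y ≤ g y)
    {x : E} (hx : f x = g x) : gen Q β f x ≤ gen Q β g x := by
  rw [← sub_nonpos, ← gen_sub, gen, Pi.sub_apply, hx, sub_self, mul_zero, sub_zero]
  refine hQ.mulVec_nonpos fun y => ?_
  simpa [hx] using hfg y

/-- The maximum principle for `𝒬 - β`. -/
lemma nonpos_of_gen_nonneg (hQ : IsMarkovGenerator Q) {β : ℝ} (hβ : 0 < β) {u : E → ℝ}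
    {A : Set E} (hA : ∀ x ∈ A, u x ≤ 0) (hgen : ∀ x ∉ A, 0 ≤ gen Q β u x) (x : E) : u x ≤ 0 := by
  obtain ⟨m, -, hm⟩ := Finset.exists_max_image Finset.univ u ⟨x, Finset.mem_univ x⟩
  have hmax : ∀ y, u y ≤ u m := fun y => hm y (Finset.mem_univ y)
  refine (hmax x).trans (not_lt.1 fun hpos => ?_)
  have h1 := hgen m fun hmA => (hA m hmA).not_gt hpos
  have h2 := hQ.mulVec_nonpos hmax
  rw [gen] at h1
  nlinarith [mul_pos hβ hpos]

lemma le_of_gen_le_gen (hQ : IsMarkovGenerator Q) {β : ℝ} (hβ : 0 < β) {f g : E → ℝ}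
    {A : Set E} (hA : ∀ x ∈ A, f x ≤ g x) (hgen : ∀ x ∉ A, gen Q β g x ≤ gen Q β f x) (x : E) :
    f x ≤ g x := by
  have := nonpos_of_gen_nonneg hQ hβ (u := f - g) (A := A)
    (fun x hx => sub_nonpos.2 (hA x hx))
    (fun x hx => by
      rw [gen_sub]
      exact sub_nonneg.2 (hgen x hx)) x
  exact sub_nonpos.1 this

/-- Comparison gives uniqueness, and a square linear system with unique solutions is solvable. -/
lemma exists_dirichlet (hQ : IsMarkovGenerator Q) {β : ℝ} (hβ : 0 < β) (A : Set E) (b : E → ℝ) :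
    ∃ f : E → ℝ, (∀ x ∈ A, f x = b x) ∧ ∀ x ∉ A, gen Q β f x = 0 := by
  classical
  let L : (E → ℝ) →ₗ[ℝ] (E → ℝ) :=
    { toFun := fun f x => if x ∈ A then f x else gen Q β f x
      map_add' := fun f g => by
        ext x
        simp only [Pi.add_apply, gen_add]
        split_ifs <;> rfl
      map_smul' := fun c f => by
        ext x
        simp only [Pi.smul_apply, smul_eq_mul, gen_smul, RingHom.id_apply]
        split_ifs <;> rfl }
  have hL : ∀ f x, L f x = if x ∈ A then f x else gen Q β f x := fun _ _ => rfl
  have hinj : Function.Injective L := by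
    intro f g hfg
    have h1 : ∀ x ∈ A, f x = g x := fun x hx => by
      simpa [hL, hx] using congrFun hfg x
    have h2 : ∀ x ∉ A, gen Q β f x = gen Q β g x := fun x hx => by
      simpa [hL, hx] using congrFun hfg x
    funext x
    exact le_antisymm
      (le_of_gen_le_gen hQ hβ (fun y hy => (h1 y hy).le) (fun y hy => (h2 y hy).ge) x)
      (le_of_gen_le_gen hQ hβ (fun y hy => (h1 y hy).ge) (fun y hy => (h2 y hy).le) x)
  obtain ⟨f, hf⟩ := LinearMap.injective_iff_surjective.1 hinj
    (fun x => if x ∈ A then b x else 0)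
  refine ⟨f, fun x hx => ?_, fun x hx => ?_⟩
  · simpa [hL, hx] using congrFun hf x
  · simpa [hL, hx] using congrFun hf x

end Deterministic

/-! ### The inner recursion, best replies and comparison of the two runs. -/

section Algorithm

variable {E : Type*} [Fintype E] [TopologicalSpace E] [DiscreteTopology E]
  [MeasurableSpace E] [BorelSpace E] {Q : Matrix E E ℝ} {Ω : Type*} [MeasurableSpace Ω]
  {M : MarkovChain Q Ω} {β : ℝ} {ψ φ : E → ℝ}

/-- For disjoint `D` and `S`, the payoff of the two hitting times solves the Dirichlet problem. -/
lemma payoff_hit_spec (hQ : IsMarkovGenerator Q) (hβ : 0 < β) {D S : Set E}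
    (hDS : Disjoint D S) :
    (∀ x ∈ D, payoff M β ψ φ (hit M D) (hit M S) x = ψ x) ∧
      (∀ x ∈ S, payoff M β ψ φ (hit M D) (hit M S) x = φ x) ∧
      ∀ x ∉ D ∪ S, gen Q β (payoff M β ψ φ (hit M D) (hit M S)) x = 0 := by
  classical
  obtain ⟨f, hf, hgen⟩ := exists_dirichlet hQ hβ (D ∪ S) (fun x => if x ∈ D then ψ x else φ x)
  have hD : ∀ x ∈ D, f x = ψ x := fun x hx => by rw [hf x (Or.inl hx), if_pos hx]
  have hS : ∀ x ∈ S, f x = φ x := fun x hx => by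
    rw [hf x (Or.inr hx), if_neg (Set.disjoint_right.1 hDS hx)]
  have heq : payoff M β ψ φ (hit M D) (hit M S) = f :=
    funext (payoff_hit_eq_of_dirichlet M hβ hD hS hgen)
  rw [heq]
  exact ⟨hD, hS, hgen⟩

lemma antitone_innerD (S : Set E) : Antitone (innerD M β ψ φ S) :=
  antitone_nat_of_succ_le fun _ => Set.inter_subset_right

lemma disjoint_innerD (S : Set E) (n : ℕ) : Disjoint (innerD M β ψ φ S n) S :=
  Set.disjoint_left.2 fun _ hx => (antitone_innerD S (Nat.zero_le n) hx).2

/-- The function `V^{(n)}` of the inner recursion dominates `ψ`. -/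
lemma le_payoff_innerD (hQ : IsMarkovGenerator Q) (hβ : 0 < β) (hψφ : ∀ x, ψ x ≤ φ x)
    (S : Set E) (n : ℕ) (x : E) :
    ψ x ≤ payoff M β ψ φ (hit M (innerD M β ψ φ S n)) (hit M S) x := by
  induction n generalizing x with
  | zero =>
    obtain ⟨hD, hS, hgen⟩ := payoff_hit_spec (M := M) (ψ := ψ) (φ := φ) hQ hβ
      (disjoint_innerD (M := M) (β := β) (ψ := ψ) (φ := φ) S 0)
    refine le_of_gen_le_gen hQ hβ (A := innerD M β ψ φ S 0 ∪ S) ?_ (fun y hy => ?_) x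
    · rintro y (hy | hy)
      · exact (hD y hy).ge
      · exact (hψφ y).trans (hS y hy).ge
    · rw [hgen y hy]
      by_contra hlt
      -- Off `D^{(1)} ∪ S` the function `ψ` is a strict subsolution, so it lies below the Dirichlet
      -- solution.
      exact hy (Or.inl ⟨(not_le.1 hlt).le, fun h => hy (Or.inr h)⟩)
  | succ n ih =>
    -- The functions `V^{(n)}` increase with `n`: a point is dropped from `D^{(n)}` only where
    -- `𝒬[V^{(n)}] - βV^{(n)} > 0`, which makes `V^{(n)}` a subsolution off the next boundary set.
    refine (ih x).trans ?_
    obtain ⟨hD, hS, hgen⟩ := payoff_hit_spec (M := M) (ψ := ψ) (φ := φ) hQ hβ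
      (disjoint_innerD (M := M) (β := β) (ψ := ψ) (φ := φ) S n)
    obtain ⟨hD', hS', hgen'⟩ := payoff_hit_spec (M := M) (ψ := ψ) (φ := φ) hQ hβ
      (disjoint_innerD (M := M) (β := β) (ψ := ψ) (φ := φ) S (n + 1))
    refine le_of_gen_le_gen hQ hβ (A := innerD M β ψ φ S (n + 1) ∪ S) ?_ (fun y hy => ?_) x
    · rintro y (hy | hy)
      · rw [hD' y hy, hD y (antitone_innerD S n.le_succ hy)]
      · rw [hS' y hy, hS y hy]
    · rw [hgen' y hy]
      by_cases hyD : y ∈ innerD M β ψ φ S n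
      · by_contra hlt
        exact hy (Or.inl ⟨(not_le.1 hlt).le, hyD⟩)
      · exact (hgen y fun h => h.elim hyD fun h => hy (Or.inr h)).ge

instance (M : MarkovChain Q Ω) : Nonempty (StoppingTime M) := ⟨hitTime M ∅⟩

lemma bestReply_le_of_supersolution (hβ : 0 < β) (hψ : ∀ x, 0 ≤ ψ x) (hψφ : ∀ x, ψ x ≤ φ x)
    {f : E → ℝ} {S : Set E} (hψf : ∀ x, ψ x ≤ f x) (hφf : ∀ x ∈ S, φ x ≤ f x)
    (hgen : ∀ x ∉ S, gen Q β f x ≤ 0) (x : E) : bestReply M β ψ φ S x ≤ f x :=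
  ciSup_le fun τ => payoff_le_of_supersolution M hβ hψ (fun y => (hψ y).trans (hψφ y)) hψf hφf
    hgen τ x

/-- The content is boundedness of the supremum: the constant `∑ |φ|` is a supersolution above both
payoffs. -/
lemma payoff_le_bestReply (hQ : IsMarkovGenerator Q) (hβ : 0 < β) (hψ : ∀ x, 0 ≤ ψ x)
    (hψφ : ∀ x, ψ x ≤ φ x) (S : Set E) (τ : StoppingTime M) (x : E) :
    payoff M β ψ φ τ.1 (hit M S) x ≤ bestReply M β ψ φ S x := by
  have hC : ∀ y, φ y ≤ ∑ z, |φ z| := fun y =>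
    (le_abs_self _).trans (norm_apply_le_sum φ y)
  refine le_ciSup (f := fun τ : StoppingTime M => payoff M β ψ φ τ.1 (hit M S) x)
    ⟨∑ z, |φ z|, ?_⟩ τ
  rintro _ ⟨τ, rfl⟩
  refine payoff_le_of_supersolution M (f := fun _ => ∑ z, |φ z|) hβ hψ
    (fun y => (hψ y).trans (hψφ y)) (fun y => (hψφ y).trans (hC y)) (fun y _ => hC y)
    (fun y _ => ?_) τ x
  rw [gen, sub_nonpos]
  exact (hQ.mulVec_nonpos fun _ => le_rfl).trans
    (mul_nonneg hβ.le (Finset.sum_nonneg fun _ _ => abs_nonneg _))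

/-- The inner recursion stabilizes, and yields the best reply to `h(S)`. -/
lemma exists_innerD_stable (hQ : IsMarkovGenerator Q) (hβ : 0 < β) (hψ : ∀ x, 0 ≤ ψ x)
    (hψφ : ∀ x, ψ x ≤ φ x) (S : Set E) :
    ∃ N, (⋂ n, innerD M β ψ φ S n) = innerD M β ψ φ S N ∧
      bestReply M β ψ φ S = payoff M β ψ φ (hit M (innerD M β ψ φ S N)) (hit M S) ∧
      ∀ x ∉ S, gen Q β (bestReply M β ψ φ S) x ≤ 0 := by
  -- `E` is finite, so the decreasing sets become constant.
  obtain ⟨N, hN⟩ := WellFoundedGT.monotone_chain_condition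
    (α := (Set E)ᵒᵈ) ⟨fun n => OrderDual.toDual (innerD M β ψ φ S n), fun _ _ h =>
      antitone_innerD S h⟩
  replace hN : ∀ m, N ≤ m → innerD M β ψ φ S N = innerD M β ψ φ S m := hN
  obtain ⟨hD, hS, hgen⟩ := payoff_hit_spec (M := M) (ψ := ψ) (φ := φ) hQ hβ
    (disjoint_innerD (M := M) (β := β) (ψ := ψ) (φ := φ) S N)
  have hsuper : ∀ x ∉ S,
      gen Q β (payoff M β ψ φ (hit M (innerD M β ψ φ S N)) (hit M S)) x ≤ 0 := by
    intro x hx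
    by_cases hxD : x ∈ innerD M β ψ φ S N
    · rw [hN (N + 1) N.le_succ] at hxD
      exact hxD.1
    · exact (hgen x fun h => h.elim hxD hx).le
  -- Verification: this payoff is attained by a stopping time and is itself a supersolution
  -- dominating every payoff.
  have heq : bestReply M β ψ φ S =
      payoff M β ψ φ (hit M (innerD M β ψ φ S N)) (hit M S) := by
    funext x
    exact le_antisymm
      (bestReply_le_of_supersolution hβ hψ hψφ (le_payoff_innerD hQ hβ hψφ S N)
        (fun y hy => (hS y hy).ge) hsuper x)
      (payoff_le_bestReply hQ hβ hψ hψφ S (hitTime M _) x)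
  refine ⟨N, ?_, heq, heq ▸ hsuper⟩
  refine Set.Subset.antisymm (Set.iInter_subset _ N) (Set.subset_iInter fun n => ?_)
  rcases le_total N n with h | h
  · exact (hN n h).subset
  · exact antitone_innerD S h

lemma le_bestReply (hQ : IsMarkovGenerator Q) (hβ : 0 < β) (hψ : ∀ x, 0 ≤ ψ x)
    (hψφ : ∀ x, ψ x ≤ φ x) (S : Set E) (x : E) : ψ x ≤ bestReply M β ψ φ S x := by
  obtain ⟨N, -, heq, -⟩ := exists_innerD_stable (M := M) hQ hβ hψ hψφ S
  rw [heq]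
  exact le_payoff_innerD hQ hβ hψφ S N x

lemma bestReply_eq_of_mem (hQ : IsMarkovGenerator Q) (hβ : 0 < β) (hψ : ∀ x, 0 ≤ ψ x)
    (hψφ : ∀ x, ψ x ≤ φ x) {S : Set E} {x : E} (hx : x ∈ S) :
    bestReply M β ψ φ S x = φ x := by
  obtain ⟨N, -, heq, -⟩ := exists_innerD_stable (M := M) hQ hβ hψ hψφ S
  rw [heq]
  exact (payoff_hit_spec hQ hβ (disjoint_innerD S N)).2.1 x hx

lemma gen_bestReply_nonpos (hQ : IsMarkovGenerator Q) (hβ : 0 < β) (hψ : ∀ x, 0 ≤ ψ x)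
    (hψφ : ∀ x, ψ x ≤ φ x) {S : Set E} {x : E} (hx : x ∉ S) :
    gen Q β (bestReply M β ψ φ S) x ≤ 0 := by
  obtain ⟨N, -, -, h⟩ := exists_innerD_stable (M := M) hQ hβ hψ hψφ S
  exact h x hx

lemma gen_bestReply_eq_zero (hQ : IsMarkovGenerator Q) (hβ : 0 < β) (hψ : ∀ x, 0 ≤ ψ x)
    (hψφ : ∀ x, ψ x ≤ φ x) {S : Set E} {x : E} (hx : x ∉ S)
    (hne : bestReply M β ψ φ S x ≠ ψ x) : gen Q β (bestReply M β ψ φ S) x = 0 := by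
  obtain ⟨N, -, heq, -⟩ := exists_innerD_stable (M := M) hQ hβ hψ hψφ S
  obtain ⟨hD, -, hgen⟩ := payoff_hit_spec (M := M) (ψ := ψ) (φ := φ) hQ hβ
    (disjoint_innerD (M := M) (β := β) (ψ := ψ) (φ := φ) S N)
  rw [heq] at hne ⊢
  exact hgen x fun h => h.elim (fun h => hne (hD x h)) hx

/-- The limit of the inner recursion is the contact set `{V = ψ}` outside `S`. -/
lemma iInter_innerD_eq (hQ : IsMarkovGenerator Q) (hβ : 0 < β) (hψ : ∀ x, 0 ≤ ψ x)
    (hψφ : ∀ x, ψ x ≤ φ x) (S : Set E) :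
    ⋂ n, innerD M β ψ φ S n = {x | x ∉ S ∧ bestReply M β ψ φ S x = ψ x} := by
  ext x
  constructor
  · obtain ⟨N, hN, heq, -⟩ := exists_innerD_stable (M := M) hQ hβ hψ hψφ S
    intro hx
    rw [hN] at hx
    refine ⟨Set.disjoint_left.1 (disjoint_innerD S N) hx, ?_⟩
    rw [heq]
    exact (payoff_hit_spec hQ hβ (disjoint_innerD S N)).1 x hx
  · rintro ⟨hxS, hx⟩
    -- At a contact point, `ψ` and then every `V^{(n)}` touch `V` from below, so they inherit the
    -- sign of `𝒬[V] - βV`; the point is never removed.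
    have hV := gen_bestReply_nonpos (M := M) hQ hβ hψ hψφ hxS
    refine Set.mem_iInter.2 fun n => ?_
    induction n with
    | zero =>
      exact ⟨(gen_le_gen_of_eq hQ β (le_bestReply hQ hβ hψ hψφ S) hx.symm).trans hV, hxS⟩
    | succ n ih =>
      refine ⟨(gen_le_gen_of_eq hQ β
        (payoff_le_bestReply hQ hβ hψ hψφ S (hitTime M _)) ?_).trans hV, ih⟩
      rw [hx]
      exact (payoff_hit_spec hQ hβ (disjoint_innerD S n)).1 x ih

/-- Comparison of the best reply to `h(S)` with a function that is a supersolution of the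
obstacle problem off a larger set `A`. -/
lemma bestReply_le_of_gen_nonpos (hQ : IsMarkovGenerator Q) (hβ : 0 < β) (hψ : ∀ x, 0 ≤ ψ x)
    (hψφ : ∀ x, ψ x ≤ φ x) {S A : Set E} (hSA : S ⊆ A) {f : E → ℝ} (hψf : ∀ x, ψ x ≤ f x)
    (hA : ∀ x ∈ A, bestReply M β ψ φ S x ≤ f x) (hgen : ∀ x ∉ A, gen Q β f x ≤ 0) (x : E) :
    bestReply M β ψ φ S x ≤ f x := by
  refine le_of_gen_le_gen hQ hβ (A := A ∪ {y | bestReply M β ψ φ S y = ψ y}) ?_ (fun y hy => ?_) x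
  · rintro y (hy | hy)
    · exact hA y hy
    · exact (show bestReply M β ψ φ S y = ψ y from hy).trans_le (hψf y)
  · rw [gen_bestReply_eq_zero hQ hβ hψ hψφ (fun h => hy (Or.inl (hSA h))) fun h => hy (Or.inr h)]
    exact hgen y fun h => hy (Or.inl h)

/-- The empty set is never hit, so the opponent never stops and `φ` is irrelevant. General facts on
best replies thus apply to `V₀`. -/
lemma V₀_eq_bestReply_empty (M : MarkovChain Q Ω) (β : ℝ) (ψ φ : E → ℝ) :
    V₀ M β ψ = bestReply M β ψ φ ∅ := by
  funext x
  refine iSup_congr fun τ => integral_congr_ae (ae_of_all _ fun ω => ?_)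
  have h : hit M ∅ ω = ⊤ := congrFun (hittingAfter_empty 0) ω
  exact (if_pos (h ▸ le_top)).symm

lemma eq_subset_runS {S₁ : Set E} (h : {x | φ x = ψ x} ⊆ S₁) (k : ℕ) :
    {x | φ x = ψ x} ⊆ runS M β ψ φ S₁ k := by
  cases k with
  | zero => exact h
  | succ k => exact Set.subset_union_right

/-- Along the run started from `{V₀ > φ} ∪ {φ = ψ}`, the value functions stay below `φ`. -/
lemma runV_initS_le (hQ : IsMarkovGenerator Q) (hβ : 0 < β) (hψ : ∀ x, 0 ≤ ψ x)
    (hψφ : ∀ x, ψ x ≤ φ x) (k : ℕ) (x : E) :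
    runV M β ψ φ (initS M β ψ φ) k x ≤ φ x := by
  induction k generalizing x with
  | zero =>
    by_cases hx : x ∈ initS M β ψ φ
    · exact (bestReply_eq_of_mem hQ hβ hψ hψφ hx).le
    · have h0 : V₀ M β ψ x ≤ φ x := not_lt.1 fun h => hx (Or.inl h)
      refine le_trans ?_ h0
      have hle : ∀ y, ψ y ≤ V₀ M β ψ y := fun y => by
        rw [V₀_eq_bestReply_empty M β ψ φ]
        exact le_bestReply hQ hβ hψ hψφ ∅ y
      -- `V₀` is a global supersolution above `ψ`, and at least `φ` on the initial set, so it
      -- dominates the first best reply.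
      refine bestReply_le_of_supersolution hβ hψ hψφ hle ?_ (fun y _ => ?_) x
      · rintro y (hy | hy)
        · exact le_of_lt hy
        · exact (show φ y = ψ y from hy).trans_le (hle y)
      · rw [V₀_eq_bestReply_empty M β ψ φ]
        exact gen_bestReply_nonpos hQ hβ hψ hψφ (Set.notMem_empty y)
  | succ k ih =>
    refine le_trans ?_ (ih x)
    have hsub : runS M β ψ φ (initS M β ψ φ) (k + 1) ⊆ runS M β ψ φ (initS M β ψ φ) k :=
      Set.union_subset Set.inter_subset_left (eq_subset_runS Set.subset_union_right k)
    -- The previous value is a supersolution off the new, smaller set: points leave `S_k` only where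
    -- `𝒬[V_k] - βV_k < 0`.
    refine bestReply_le_of_supersolution hβ hψ hψφ (le_bestReply hQ hβ hψ hψφ _)
      (fun y hy => (bestReply_eq_of_mem hQ hβ hψ hψφ (hsub hy)).ge) (fun y hy => ?_) x
    by_cases hyS : y ∈ runS M β ψ φ (initS M β ψ φ) k
    · by_contra hlt
      exact hy (Or.inl ⟨hyS, (not_le.1 hlt).le⟩)
    · exact gen_bestReply_nonpos hQ hβ hψ hψφ hyS

/-- On the larger set the larger run has value `φ`, which bounds the smaller run's value; off it,
the larger run's value is a supersolution. -/
lemma runV_initS_le_runV_initS' (hQ : IsMarkovGenerator Q) (hβ : 0 < β) (hψ : ∀ x, 0 ≤ ψ x)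
    (hψφ : ∀ x, ψ x ≤ φ x) {k : ℕ}
    (hS : runS M β ψ φ (initS M β ψ φ) k ⊆ runS M β ψ φ (initS' M β ψ φ) k) (x : E) :
    runV M β ψ φ (initS M β ψ φ) k x ≤ runV M β ψ φ (initS' M β ψ φ) k x :=
  bestReply_le_of_gen_nonpos hQ hβ hψ hψφ hS (le_bestReply hQ hβ hψ hψφ _)
    (fun y hy => (runV_initS_le hQ hβ hψ hψφ k y).trans
      (bestReply_eq_of_mem hQ hβ hψ hψφ hy).ge)
    (fun _ hy => gen_bestReply_nonpos hQ hβ hψ hψφ hy) x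

lemma runS_initS_subset (hQ : IsMarkovGenerator Q) (hβ : 0 < β) (hψ : ∀ x, 0 ≤ ψ x)
    (hψφ : ∀ x, ψ x ≤ φ x) (k : ℕ) :
    runS M β ψ φ (initS M β ψ φ) k ⊆ runS M β ψ φ (initS' M β ψ φ) k := by
  induction k with
  | zero =>
    rintro x (hx | hx)
    · exact (show φ x < V₀ M β ψ x from hx).le
    · refine (show φ x = ψ x from hx).trans_le ?_
      rw [V₀_eq_bestReply_empty M β ψ φ]
      exact le_bestReply hQ hβ hψ hψφ ∅ x
  | succ k ih =>
    rintro x (⟨hx, hgen⟩ | hx)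
    · refine Or.inl ⟨ih hx, (show (0 : ℝ) ≤ gen Q β (bestReply M β ψ φ (runS M β ψ φ (initS M β ψ φ) k)) x from hgen).trans ?_⟩
      -- The two values touch at `x`, both being `φ x` there, so the sign condition transfers.
      refine gen_le_gen_of_eq hQ β (runV_initS_le_runV_initS' hQ hβ hψ hψφ ih) ?_
      rw [runV, runV, bestReply_eq_of_mem hQ hβ hψ hψφ hx, bestReply_eq_of_mem hQ hβ hψ hψφ (ih hx)]
    · exact Or.inr hx

end Algorithm

end StoppingGame

end

theorem theorem3p10 {E : Type*} [Fintype E] [TopologicalSpace E] [DiscreteTopology E]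
    [MeasurableSpace E] [BorelSpace E] {Ω : Type*} [MeasurableSpace Ω]
    (Q : Matrix E E ℝ) (hQ : StoppingGame.IsMarkovGenerator Q)
    (M : StoppingGame.MarkovChain Q Ω)
    (β : ℝ) (hβ : 0 < β) (ψ φ : E → ℝ) (hψ : ∀ x, 0 ≤ ψ x) (hψφ : ∀ x, ψ x ≤ φ x) (k : ℕ) :
    StoppingGame.runS M β ψ φ (StoppingGame.initS M β ψ φ) k ⊆
        StoppingGame.runS M β ψ φ (StoppingGame.initS' M β ψ φ) k ∧
      StoppingGame.runD M β ψ φ (StoppingGame.initS' M β ψ φ) k ⊆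
        StoppingGame.runD M β ψ φ (StoppingGame.initS M β ψ φ) k ∧
      ∀ x, StoppingGame.runV M β ψ φ (StoppingGame.initS M β ψ φ) k x ≤
        StoppingGame.runV M β ψ φ (StoppingGame.initS' M β ψ φ) k x := by
  have hS := StoppingGame.runS_initS_subset (M := M) hQ hβ hψ hψφ k
  have hV := StoppingGame.runV_initS_le_runV_initS' (M := M) hQ hβ hψ hψφ hS
  refine ⟨hS, ?_, hV⟩
  rw [StoppingGame.runD, StoppingGame.runD, StoppingGame.iInter_innerD_eq hQ hβ hψ hψφ,
    StoppingGame.iInter_innerD_eq hQ hβ hψ hψφ]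
  rintro x ⟨hx, hxψ⟩
  -- Squeeze: `ψ ≤ V_k ≤ Ṽ_k = ψ` at `x`.
  exact ⟨fun h => hx (hS h), le_antisymm ((hV x).trans_eq hxψ)
    (StoppingGame.le_bestReply hQ hβ hψ hψφ _ x)⟩
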